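/- Let $q$ be a complex number with $0<|q|<1$. Write $(x;q)_n=\prod_{i=0}^{n-1}(1-q^ix)$, $(x,y;q)_n=(x;q)_n(y;q)_n$, $(x;q)_\infty=\prod_{i\ge 0}(1-q^ix)$, $j(x;q)=(x;q)_\infty(q/x;q)_\infty(q;q)_\infty$ for $x\ne0$, $J_{b,m}=j(q^b;q^m)$ and $J_m=J_{m,3m}$ for integers $b,m$ with $m\ge1$, and let $$m(x,q,z)=\frac{1}{j(z;q)}\sum_{r=-\infty}^{\infty}\frac{(-1)^rq^{\binom r2}z^r}{1-q^{r-1}xz}$$ be the Appell–Lerch sum. Let $a$ be a nonzero complex number with $a^4\neq q^{4k}$ for every integer $k$ (so that every denominator below is nonzero). Then the series on the left-hand side below converges absolutely and $$\Big(1+\frac1a\Big)\sum_{n=0}^{\infty}\frac{(-aq,-q/a;q)_n\,q^{n+1}}{(q;q^2)_{n+1}}=-m(a,q,-1)+\frac{j(-a;q)}{J_{1,2}}\,m(a^2,q^2,-1)-a\,\frac{J_4^3}{J_2^3}\,\frac{j(a;q)\,j(qa^2;q^2)}{j(a^4;q^4)}.$$ -/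

import Mathlib

namespace AppellLerch

/-- The finite `q`-Pochhammer symbol `(x;q)_n = ∏_{i=0}^{n-1} (1 - q^i x)`. -/
noncomputable def qPoch (x q : ℂ) (n : ℕ) : ℂ :=
  ∏ i ∈ Finset.range n, (1 - q ^ i * x)

/-- The infinite `q`-Pochhammer symbol `(x;q)_∞ = ∏_{i ≥ 0} (1 - q^i x)`
(convergent for `|q| < 1`). -/
noncomputable def qPochInf (x q : ℂ) : ℂ :=
  ∏' i : ℕ, (1 - q ^ i * x)

/-- The theta function `j(x;q) = (x;q)_∞ (q/x;q)_∞ (q;q)_∞`. -/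
noncomputable def jTheta (x q : ℂ) : ℂ :=
  qPochInf x q * qPochInf (q / x) q * qPochInf q q

/-- `J_{a,m} = j(q^a;q^m)` for integers `a, m` with `m` positive. -/
noncomputable def J₂ (q : ℂ) (a : ℤ) (m : ℕ) : ℂ :=
  jTheta (q ^ a) (q ^ m)

/-- `J_m = J_{m,3m}`. -/
noncomputable def J₁ (q : ℂ) (m : ℕ) : ℂ :=
  J₂ q m (3 * m)

/-- The Appell–Lerch sum
`m(x,q,z) = j(z;q)⁻¹ ∑_{r ∈ ℤ} (-1)^r q^{r(r-1)/2} z^r / (1 - q^{r-1} x z)`.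
The integer division `r * (r - 1) / 2` is exact. -/
noncomputable def appellM (x q z : ℂ) : ℂ :=
  1 / jTheta z q *
    ∑' r : ℤ, (-1) ^ r * q ^ (r * (r - 1) / 2) * z ^ r / (1 - q ^ (r - 1) * x * z)

end AppellLerch

open Filter Topology

namespace AppellLerch

/-! Let D(a) be the left side minus the right side (`defect`), viewed as a function of a for fixed
q. Each ingredient has a first-order functional equation under a ↦ qa. For the series it comes from
telescoping (`tsum_mockTerm_q_mul`), for the Appell–Lerch sums from an index shift
(`lerchSum_q_mul`), and for the theta quotient from `jTheta_q_mul`. The inhomogeneous terms cancel,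
leaving D(qa) = -a D(a) (`defect_q_mul`).

Since j(qa;q) = -a⁻¹ j(a;q), the product D(a) j(a;q) is invariant under a ↦ qa. Its only possible
singularities in the annulus |q| < |a| ≤ 1 are the fourth roots of unity, where D has at most simple
poles. The residues vanish (`residue_sum_eq_zero`): the theta quotient is chosen to cancel the pole
of m(a,q,-1) at -1 and those of m(a²,q²,-1) at ±i, and it has none at 1.

A q-invariant function on ℂ \ {0} with only removable singularities is constant, by compactness of
the closed annulus and Liouville (`exists_eventuallyEq_const`). Near a = 1 the product tends to 0,
because j(1;q) = 0 while (a - 1) D(a) → 0. So the constant is 0, and D vanishes wherever j(a;q) ≠ 0,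
in particular at every regular point. -/

/-! ### Infinite q-products and the theta function -/

lemma summable_norm_pow_mul {q : ℂ} (hq : ‖q‖ < 1) (x : ℂ) :
    Summable fun i : ℕ => ‖q ^ i * x‖ := by
  simp only [norm_mul, norm_pow]
  exact (summable_geometric_of_lt_one (norm_nonneg q) hq).mul_right _

lemma multipliable_one_sub_pow_mul {q : ℂ} (hq : ‖q‖ < 1) (x : ℂ) :
    Multipliable fun i : ℕ => 1 - q ^ i * x := by
  simpa [sub_eq_add_neg] using
    multipliable_one_add_of_summable (f := fun i : ℕ => -(q ^ i * x))
      (by simpa using summable_norm_pow_mul hq x)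

lemma tendsto_qPoch {q : ℂ} (hq : ‖q‖ < 1) (x : ℂ) :
    Tendsto (qPoch x q) atTop (𝓝 (qPochInf x q)) :=
  (multipliable_one_sub_pow_mul hq x).hasProd.tendsto_prod_nat

lemma qPoch_succ (x q : ℂ) (n : ℕ) : qPoch x q (n + 1) = qPoch x q n * (1 - q ^ n * x) :=
  Finset.prod_range_succ _ _

lemma qPoch_succ' (x q : ℂ) (n : ℕ) : qPoch x q (n + 1) = (1 - x) * qPoch (q * x) q n := by
  rw [qPoch, Finset.prod_range_succ', mul_comm]
  simp [qPoch, pow_succ, mul_assoc]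

lemma qPochInf_eq_mul {q : ℂ} (hq : ‖q‖ < 1) (x : ℂ) :
    qPochInf x q = (1 - x) * qPochInf (q * x) q := by
  refine tendsto_nhds_unique ((tendsto_qPoch hq x).comp (tendsto_add_atTop_nat 1)) ?_
  refine ((tendsto_qPoch hq (q * x)).const_mul (1 - x)).congr fun n => ?_
  simp [qPoch_succ']

lemma qPochInf_ne_zero {q x : ℂ} (hq : ‖q‖ < 1) (hx : ∀ i : ℕ, q ^ i * x ≠ 1) :
    qPochInf x q ≠ 0 := by
  have := tprod_one_add_ne_zero_of_summable (f := fun i : ℕ => -(q ^ i * x))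
    (fun i h => hx i (by linear_combination -h)) (by simpa using summable_norm_pow_mul hq x)
  simpa [qPochInf, sub_eq_add_neg] using this

lemma differentiable_qPochInf {q : ℂ} (hq : ‖q‖ < 1) :
    Differentiable ℂ fun x => qPochInf x q := by
  intro x
  have hu := (summable_geometric_of_lt_one (norm_nonneg q) hq).mul_right (‖x‖ + 1)
  have h := Summable.hasProdLocallyUniformlyOn_nat_one_add (f := fun (i : ℕ) (y : ℂ) => -(q ^ i * y))
    (Metric.isOpen_ball (x := x) (ε := 1)) hu (Eventually.of_forall fun i y hy => by
      have : ‖y‖ ≤ ‖x‖ + 1 := by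
        have := norm_sub_norm_le y x
        rw [Metric.mem_ball, dist_eq_norm] at hy
        linarith
      simpa using mul_le_mul_of_nonneg_left this (by positivity)) (fun i => by fun_prop)
  have h2 := h.differentiableOn (Eventually.of_forall fun s => by fun_prop)
    Metric.isOpen_ball
  have := h2.differentiableAt (Metric.ball_mem_nhds x one_pos)
  simpa [qPochInf, sub_eq_add_neg] using this

lemma pow_mul_ne_one {q x : ℂ} (hq : ‖q‖ < 1) (hx : ‖x‖ < 1) (i : ℕ) : q ^ i * x ≠ 1 := by
  intro h
  have h1 := congrArg norm h
  rw [norm_mul, norm_pow, norm_one] at h1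
  nlinarith [pow_le_one₀ (norm_nonneg q) hq.le (n := i), norm_nonneg x]

lemma qPochInf_ne_zero_of_norm_lt {q x : ℂ} (hq : ‖q‖ < 1) (hx : ‖x‖ < 1) :
    qPochInf x q ≠ 0 :=
  qPochInf_ne_zero hq (pow_mul_ne_one hq hx)

lemma qPoch_ne_zero_of_norm_lt {q x : ℂ} (hq : ‖q‖ < 1) (hx : ‖x‖ < 1) (n : ℕ) :
    qPoch x q n ≠ 0 :=
  Finset.prod_ne_zero_iff.2 fun i _ => sub_ne_zero.2 (pow_mul_ne_one hq hx i).symm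

lemma norm_pow_lt_one {q : ℂ} (hq : ‖q‖ < 1) {n : ℕ} (hn : n ≠ 0) : ‖q ^ n‖ < 1 := by
  rw [norm_pow]; exact pow_lt_one₀ (norm_nonneg q) hq hn

lemma jTheta_one (q : ℂ) (hq : ‖q‖ < 1) : jTheta 1 q = 0 := by
  rw [jTheta, qPochInf_eq_mul hq 1]; simp

/-- The shift drops the factor 1 - x from one product and adds 1 - x⁻¹ to the other, and 1 - x⁻¹ =
-x⁻¹(1 - x). Nothing is divided by 1 - x, so zeros of the theta function are covered. -/
lemma jTheta_q_mul {q x : ℂ} (hq : ‖q‖ < 1) (hq0 : q ≠ 0) (hx : x ≠ 0) :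
    jTheta (q * x) q = -x⁻¹ * jTheta x q := by
  have h : q / (q * x) = x⁻¹ := by field_simp
  rw [jTheta, jTheta, h, qPochInf_eq_mul hq x⁻¹, qPochInf_eq_mul hq x, div_eq_mul_inv]
  field_simp
  ring

lemma jTheta_ne_zero {q x : ℂ} (hq : ‖q‖ < 1) (hq0 : q ≠ 0) (hx0 : x ≠ 0)
    (hx : ∀ k : ℤ, x ≠ q ^ k) : jTheta x q ≠ 0 := by
  refine mul_ne_zero (mul_ne_zero ?_ ?_) (qPochInf_ne_zero_of_norm_lt hq hq)
  · refine qPochInf_ne_zero hq fun i h => hx (-i) ?_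
    rw [zpow_neg, zpow_natCast]
    exact eq_inv_of_mul_eq_one_right h
  · refine qPochInf_ne_zero hq fun i h => hx (i + 1) ?_
    rw [zpow_add₀ hq0, zpow_natCast, zpow_one]
    field_simp at h
    exact h.symm

lemma differentiableAt_jTheta {q x : ℂ} (hq : ‖q‖ < 1) (hx : x ≠ 0) :
    DifferentiableAt ℂ (fun y => jTheta y q) x := by
  unfold jTheta
  have h1 := (differentiable_qPochInf hq) x
  have h2 : DifferentiableAt ℂ (fun y => qPochInf (q / y) q) x :=
    ((differentiable_qPochInf hq) (q / x)).comp x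
      ((differentiableAt_const q).div differentiableAt_id hx)
  exact (h1.mul h2).mul_const _

/-- Sort the indices by their residue modulo m. -/
lemma qPoch_mul (x q : ℂ) (m n : ℕ) :
    qPoch x q (m * n) = ∏ j ∈ Finset.range m, qPoch (q ^ j * x) (q ^ m) n := by
  induction n with
  | zero => simp [qPoch]
  | succ n ih =>
    rw [mul_add_one, qPoch, Finset.prod_range_add]
    change qPoch x q (m * n) * _ = _
    rw [ih, ← Finset.prod_mul_distrib]
    refine Finset.prod_congr rfl fun j _ => ?_
    rw [qPoch_succ]; ring

lemma qPochInf_eq_prod {q : ℂ} (hq : ‖q‖ < 1) (x : ℂ) {m : ℕ} (hm : m ≠ 0) :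
    qPochInf x q = ∏ j ∈ Finset.range m, qPochInf (q ^ j * x) (q ^ m) := by
  refine tendsto_nhds_unique
    ((tendsto_qPoch hq x).comp (tendsto_id.const_mul_atTop' (Nat.pos_of_ne_zero hm))) ?_
  refine (tendsto_finsetProd _ fun j _ =>
    tendsto_qPoch (norm_pow_lt_one hq hm) (q ^ j * x)).congr fun n => ?_
  simp [qPoch_mul]

lemma qPochInf_mul_neg {q : ℂ} (hq : ‖q‖ < 1) (x : ℂ) :
    qPochInf x q * qPochInf (-x) q = qPochInf (x ^ 2) (q ^ 2) := by
  refine tendsto_nhds_unique ((tendsto_qPoch hq x).mul (tendsto_qPoch hq (-x)))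
    ((tendsto_qPoch (norm_pow_lt_one hq two_ne_zero) (x ^ 2)).congr fun n => ?_)
  rw [qPoch, qPoch, qPoch, ← Finset.prod_mul_distrib]
  exact Finset.prod_congr rfl fun i _ => by ring

lemma qPochInf_q_eq {q : ℂ} (hq : ‖q‖ < 1) :
    qPochInf q q = qPochInf q (q ^ 2) * qPochInf (q ^ 2) (q ^ 2) := by
  rw [qPochInf_eq_prod hq q two_ne_zero]
  simp [Finset.prod_range_succ, pow_two]

/-- Euler's identity `(-q;q)_∞ (q;q²)_∞ = 1`. -/
lemma qPochInf_neg_mul_odd {q : ℂ} (hq : ‖q‖ < 1) :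
    qPochInf (-q) q * qPochInf q (q ^ 2) = 1 := by
  have hq2 := norm_pow_lt_one hq two_ne_zero
  have h1 := qPochInf_mul_neg hq q
  rw [qPochInf_q_eq hq] at h1
  refine mul_right_cancel₀ (qPochInf_ne_zero_of_norm_lt hq2 hq2) ?_
  linear_combination h1

/-- Splitting (q^m;q^m)_∞ by residues modulo 3 gives exactly the three products in j(q^m;q^{3m}). -/
lemma J₁_eq {q : ℂ} (hq : ‖q‖ < 1) (hq0 : q ≠ 0) {m : ℕ} (hm : m ≠ 0) :
    J₁ q m = qPochInf (q ^ m) (q ^ m) := by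
  have hqm := norm_pow_lt_one hq hm
  rw [J₁, J₂, jTheta, qPochInf_eq_prod hqm (q ^ m) three_ne_zero, zpow_natCast]
  have h : q ^ (3 * m) / q ^ m = q ^ (m * 2) := by
    rw [div_eq_iff (pow_ne_zero _ hq0), ← pow_add]; congr 1; ring
  simp only [h, Finset.prod_range_succ, Finset.range_zero, Finset.prod_empty]
  ring_nf

lemma jTheta_neg_one {q : ℂ} (hq : ‖q‖ < 1) :
    jTheta (-1) q = 2 * qPochInf (-q) q ^ 2 * qPochInf q q := by
  rw [jTheta, qPochInf_eq_mul hq (-1)]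
  simp only [mul_neg, mul_one, div_neg, div_one]
  ring

lemma J₂_one_two {q : ℂ} (hq0 : q ≠ 0) :
    J₂ q 1 2 = qPochInf q (q ^ 2) ^ 2 * qPochInf (q ^ 2) (q ^ 2) := by
  rw [J₂, jTheta, zpow_one, show q ^ 2 / q = q by field_simp]
  ring

/-! ### Gaussian binomials and the Jacobi triple product at -1 -/

/-- The Gaussian binomial coefficient. -/
noncomputable def qBinom (q : ℂ) : ℕ → ℕ → ℂ
  | _, 0 => 1
  | 0, _ + 1 => 0
  | n + 1, k + 1 => qBinom q n k + q ^ (k + 1) * qBinom q n (k + 1)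

lemma qBinom_zero_right (q : ℂ) (n : ℕ) : qBinom q n 0 = 1 := by
  cases n <;> simp [qBinom]

lemma qBinom_succ_succ (q : ℂ) (n k : ℕ) :
    qBinom q (n + 1) (k + 1) = qBinom q n k + q ^ (k + 1) * qBinom q n (k + 1) := by
  simp [qBinom]

lemma qBinom_eq_zero_of_lt (q : ℂ) {n k : ℕ} (h : n < k) : qBinom q n k = 0 := by
  induction n generalizing k with
  | zero => obtain ⟨k, rfl⟩ := Nat.exists_eq_add_one.2 h; simp [qBinom]
  | succ n ih =>
    obtain ⟨k, rfl⟩ := Nat.exists_eq_add_one.2 (Nat.zero_lt_of_lt h)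
    rw [qBinom_succ_succ, ih (by lia), ih (by lia)]; simp

lemma qBinom_mul_qPoch (q : ℂ) (n k l : ℕ) (h : k + l = n) :
    qBinom q n k * (qPoch q q k * qPoch q q l) = qPoch q q n := by
  induction n generalizing k l with
  | zero =>
    obtain ⟨rfl, rfl⟩ : k = 0 ∧ l = 0 := by lia
    simp [qBinom, qPoch]
  | succ n ih =>
    rcases k with _ | k
    · obtain rfl : l = n + 1 := by lia
      simp [qBinom_zero_right, qPoch]
    rw [qBinom_succ_succ, qPoch_succ q q n]
    rcases l with _ | l
    · obtain rfl : k = n := by lia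
      have h1 := ih k 0 rfl
      rw [qBinom_eq_zero_of_lt q (Nat.lt_succ_self k), qPoch_succ]
      linear_combination (1 - q ^ k * q) * h1
    · have h1 := ih k (l + 1) (by lia)
      have h2 := ih (k + 1) l (by lia)
      obtain rfl : k + l + 1 = n := by lia
      rw [qPoch_succ] at h1 h2 ⊢
      rw [qPoch_succ]
      linear_combination (1 - q ^ k * q) * h1 + q ^ (k + 1) * (1 - q ^ l * q) * h2

/-- The finite `q`-binomial theorem. -/
lemma qPoch_neg_eq_sum (q y : ℂ) (n : ℕ) :
    qPoch (-y) q n = ∑ k ∈ Finset.range (n + 1), q ^ k.choose 2 * qBinom q n k * y ^ k := by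
  induction n generalizing y with
  | zero => simp [qPoch, qBinom]
  | succ n ih =>
    have h := ih (q * y)
    rw [qPoch_succ', mul_neg, h, sub_neg_eq_add, add_mul, one_mul]
    rw [Finset.sum_range_succ' _ (n + 1)]
    have e : ∀ k : ℕ, q ^ (k + 1).choose 2 * qBinom q (n + 1) (k + 1) * y ^ (k + 1) =
        y * (q ^ k.choose 2 * qBinom q n k * (q * y) ^ k) +
          q ^ (k + 1).choose 2 * qBinom q n (k + 1) * (q * y) ^ (k + 1) := by
      intro k
      have hc : (k + 1).choose 2 = k.choose 2 + k := by
        rw [Nat.choose_succ_succ' k 1, Nat.choose_one_right, add_comm]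
      rw [qBinom_succ_succ, hc]; ring
    simp only [e, Finset.sum_add_distrib, ← Finset.mul_sum]
    have h2 := Finset.sum_range_succ' (fun k =>
      q ^ k.choose 2 * qBinom q n k * (q * y) ^ k) (n + 1)
    rw [Finset.sum_range_succ, qBinom_eq_zero_of_lt q (Nat.lt_succ_self n)] at h2
    simp only [qBinom_zero_right] at h2 ⊢
    linear_combination h2

/-- The 2N factors are 1 + q^e for 1 - N ≤ e ≤ N. Those with e ≤ 0 are turned into 1 + q^{-e} by the
powers of q making up q^{N(N-1)/2}. -/
lemma qPoch_mul_choose {q : ℂ} (hq0 : q ≠ 0) (N : ℕ) :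
    q ^ N.choose 2 * qPoch (-q ^ (1 - N : ℤ)) q (2 * N) = qPoch (-1) q N * qPoch (-q) q N := by
  have h1 : ∀ N : ℕ, q ^ N.choose 2 * ∏ j ∈ Finset.range N, (1 + q ^ (-j : ℤ)) =
      qPoch (-1) q N := by
    intro N
    induction N with
    | zero => simp [qPoch]
    | succ N ih =>
      have hc : (N + 1).choose 2 = N.choose 2 + N := by
        rw [Nat.choose_succ_succ' N 1, Nat.choose_one_right, add_comm]
      rw [Finset.prod_range_succ, hc, qPoch_succ, ← ih, pow_add, zpow_neg, zpow_natCast]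
      have := pow_ne_zero N hq0
      field_simp
      ring
  rw [two_mul, qPoch, Finset.prod_range_add, ← mul_assoc, ← h1, ← Finset.prod_range_reflect]
  congr 1
  · congr 1
    refine Finset.prod_congr rfl fun i hi => ?_
    have hi := Finset.mem_range.1 hi
    rw [mul_neg, sub_neg_eq_add, ← zpow_natCast q, ← zpow_add₀ hq0]
    congr 2
    lia
  · refine Finset.prod_congr rfl fun i hi => ?_
    rw [mul_neg, mul_neg, ← zpow_natCast q, ← zpow_add₀ hq0, ← zpow_natCast q i,
      ← zpow_add_one₀ hq0]
    congr 3
    push_cast; ring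

lemma two_mul_triangle (r : ℤ) : 2 * (r * (r + 1) / 2) = r * (r + 1) :=
  Int.mul_ediv_cancel' (Int.even_mul_succ_self r).two_dvd

lemma two_mul_choose_two (k : ℕ) : 2 * (k.choose 2 : ℤ) = k * (k - 1) := by
  induction k with
  | zero => simp
  | succ k ih =>
    rw [Nat.choose_succ_succ' k 1, Nat.choose_one_right]
    push_cast
    linarith

/-- This is a finite form of the triple product: the q-binomial theorem of order 2N at y = q^{1-N},
recentred by k = N + r. -/
lemma sum_triangle_qBinom {q : ℂ} (hq0 : q ≠ 0) (N : ℕ) :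
    ∑ r ∈ Finset.Icc (-N : ℤ) N, q ^ (r * (r + 1) / 2) * qBinom q (2 * N) (N + r).toNat =
      qPoch (-1) q N * qPoch (-q) q N := by
  rw [← qPoch_mul_choose hq0, qPoch_neg_eq_sum, Finset.mul_sum]
  refine Finset.sum_nbij' (fun r => (N + r).toNat) (fun k => (k : ℤ) - N) ?_ ?_ ?_ ?_ ?_
  · intro r hr; simp only [Finset.mem_Icc, Finset.mem_range] at *; lia
  · intro r hr; simp only [Finset.mem_Icc, Finset.mem_range] at *; lia
  · intro r hr; simp only [Finset.mem_Icc] at *; lia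
  · intro r hr; lia
  · intro r hr
    obtain ⟨k, hk⟩ : ∃ k : ℕ, (N : ℤ) + r = k :=
      ⟨(N + r).toNat, by simp only [Finset.mem_Icc] at hr; lia⟩
    obtain rfl : r = k - N := by lia
    rw [hk, Int.toNat_natCast]
    have e : q ^ (((k : ℤ) - N) * (k - N + 1) / 2) =
        q ^ N.choose 2 * (q ^ k.choose 2 * (q ^ (1 - N : ℤ)) ^ k) := by
      rw [← zpow_natCast (q ^ (1 - N : ℤ)), ← zpow_mul, ← zpow_natCast, ← zpow_natCast,
        ← zpow_add₀ hq0, ← zpow_add₀ hq0]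
      congr 1
      have h1 := two_mul_triangle ((k : ℤ) - N)
      have h2 := two_mul_choose_two k
      have h3 := two_mul_choose_two N
      linarith
    rw [e]; ring

/-- A linear lower bound is enough to dominate the bilateral sum by geometric series. -/
lemma triangle_ge (r : ℤ) : (r.natAbs : ℤ) - 1 ≤ r * (r + 1) / 2 := by
  have h := two_mul_triangle r
  have : 2 * ((r.natAbs : ℤ) - 1) ≤ r * (r + 1) := by
    rcases abs_cases r with ⟨h, h'⟩ | ⟨h, h'⟩ <;> rw [Int.natCast_natAbs, h]
    · nlinarith [sq_nonneg (2 * r - 1)]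
    · rcases eq_or_lt_of_le (Int.le_sub_one_of_lt h') with rfl | h''
      · norm_num
      · nlinarith [mul_nonneg (show 0 ≤ -(r + 1) by lia) (show 0 ≤ -(r + 2) by lia)]
  lia

lemma summable_norm_triangle {q : ℂ} (hq0 : q ≠ 0) (hq : ‖q‖ < 1) :
    Summable fun r : ℤ => ‖q ^ (r * (r + 1) / 2)‖ := by
  have hp : 0 < ‖q‖ := norm_pos_iff.2 hq0
  have h0 := (summable_geometric_of_lt_one hp.le hq).mul_left ‖q‖⁻¹
  have hs : Summable fun r : ℤ => ‖q‖⁻¹ * ‖q‖ ^ r.natAbs :=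
    Summable.of_nat_of_neg (by simpa using h0) (by simpa using h0)
  refine hs.of_nonneg_of_le (fun _ => norm_nonneg _) fun r => ?_
  rw [norm_zpow, ← zpow_natCast, ← zpow_neg_one, ← zpow_add₀ hp.ne']
  exact zpow_le_zpow_right_of_le_one₀ hp hq.le (by linarith [triangle_ge r])

lemma exists_norm_le_of_tendsto {u : ℕ → ℂ} {l : ℂ} (h : Tendsto u atTop (𝓝 l)) :
    ∃ M, 0 ≤ M ∧ ∀ n, ‖u n‖ ≤ M := by
  obtain ⟨M, hM⟩ := h.norm.bddAbove_range
  have hM : ∀ n, ‖u n‖ ≤ M := fun n => hM ⟨n, rfl⟩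
  exact ⟨M, (norm_nonneg _).trans (hM 0), hM⟩

/-- Let N → ∞ in `sum_triangle_qBinom`: each central Gaussian binomial tends to 1/(q;q)_∞. -/
lemma tsum_triangle {q : ℂ} (hq0 : q ≠ 0) (hq : ‖q‖ < 1) :
    ∑' r : ℤ, q ^ (r * (r + 1) / 2) = jTheta (-1) q := by
  have hne := qPochInf_ne_zero_of_norm_lt hq hq
  have hn := qPoch_ne_zero_of_norm_lt hq hq
  have ht := tendsto_qPoch hq q
  have hti := ht.inv₀ hne
  obtain ⟨M, hM0, hM⟩ := exists_norm_le_of_tendsto ht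
  obtain ⟨M', hM0', hM'⟩ := exists_norm_le_of_tendsto hti
  have hform : ∀ n k l, k + l = n →
      qBinom q n k = qPoch q q n * ((qPoch q q k)⁻¹ * (qPoch q q l)⁻¹) := by
    intro n k l h
    rw [← qBinom_mul_qPoch q n k l h]
    have := hn k
    have := hn l
    field_simp
  have hbd : ∀ n k, ‖qBinom q n k‖ ≤ M * (M' * M') := by
    intro n k
    rcases le_or_gt k n with h | h
    · rw [hform n k (n - k) (by lia), norm_mul, norm_mul]
      gcongr
      · exact hM n
      · exact hM' k
      · exact hM' (n - k)
    · rw [qBinom_eq_zero_of_lt q h, norm_zero]; positivity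
  let f : ℕ → ℤ → ℂ := fun N r => if r ∈ Finset.Icc (-N : ℤ) N then
    q ^ (r * (r + 1) / 2) * qBinom q (2 * N) (N + r).toNat else 0
  have hf : ∀ N, ∑' r, f N r = qPoch (-1) q N * qPoch (-q) q N := by
    intro N
    rw [← sum_triangle_qBinom hq0, tsum_eq_sum (s := Finset.Icc (-N : ℤ) N)
      (fun r hr => if_neg hr)]
    exact Finset.sum_congr rfl fun r hr => if_pos hr
  have hlim : Tendsto (fun N => ∑' r, f N r) atTop
      (𝓝 (∑' r : ℤ, q ^ (r * (r + 1) / 2) * (qPochInf q q)⁻¹)) := by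
    -- M bounds (q;q)_n and M' bounds its reciprocal, so M·M'² bounds every Gaussian binomial
    -- uniformly.
    refine tendsto_tsum_of_dominated_convergence
      ((summable_norm_triangle hq0 hq).mul_right (M * (M' * M'))) ?_ ?_
    · intro r
      have h1 : Tendsto (fun N : ℕ => 2 * N) atTop atTop :=
        tendsto_id.const_mul_atTop' two_pos
      have h2 : Tendsto (fun N : ℕ => ((N : ℤ) + r).toNat) atTop atTop :=
        tendsto_atTop.2 fun b => (eventually_ge_atTop (b + r.natAbs)).mono fun N h => by lia
      have h3 : Tendsto (fun N : ℕ => ((N : ℤ) - r).toNat) atTop atTop :=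
        tendsto_atTop.2 fun b => (eventually_ge_atTop (b + r.natAbs)).mono fun N h => by lia
      have h4 := ((ht.comp h1).mul ((hti.comp h2).mul (hti.comp h3))).const_mul
        (q ^ (r * (r + 1) / 2))
      have e : qPochInf q q * ((qPochInf q q)⁻¹ * (qPochInf q q)⁻¹) = (qPochInf q q)⁻¹ := by
        field_simp
      rw [e] at h4
      refine h4.congr' ?_
      filter_upwards [eventually_ge_atTop r.natAbs] with N hN
      have hm : r ∈ Finset.Icc (-N : ℤ) N := by rw [Finset.mem_Icc]; lia
      simp only [f, if_pos hm, Function.comp]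
      rw [hform (2 * N) (N + r).toNat (N - r).toNat (by lia)]
    · refine Eventually.of_forall fun N r => ?_
      simp only [f]
      split_ifs
      · rw [norm_mul]
        gcongr
        exact hbd _ _
      · rw [norm_zero]; positivity
  simp only [hf] at hlim
  have h := tendsto_nhds_unique hlim ((tendsto_qPoch hq (-1)).mul (tendsto_qPoch hq (-q)))
  rw [tsum_mul_right] at h
  rw [jTheta]
  simp only [div_neg, div_one]
  rw [← h]
  field_simp

/-! ### The Appell–Lerch sum at z = -1 -/

/-- The bilateral sum `∑_s q^{s(s+1)/2} / (q^s + x)`, the numerator of `m(x,q,-1)`. -/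
noncomputable def lerchSum (x q : ℂ) : ℂ :=
  ∑' s : ℤ, q ^ (s * (s + 1) / 2) / (q ^ s + x)

/-- Substitute r = 1 - s; the signs (-1)^r z^r cancel. -/
lemma appellM_neg_one {q : ℂ} (hq0 : q ≠ 0) (x : ℂ) :
    appellM x q (-1) = lerchSum x q / jTheta (-1) q := by
  rw [appellM, lerchSum, one_div_mul_eq_div, ← (Equiv.subLeft (1 : ℤ)).tsum_eq]
  congr 1
  refine tsum_congr fun s => ?_
  rw [Equiv.subLeft_apply, mul_right_comm, ← mul_zpow]
  have h2 : (1 - s) * (1 - s - 1) / 2 = s * (s + 1) / 2 - s := by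
    have h := two_mul_triangle s
    have h' := two_mul_triangle (-s)
    have e : (1 - s) * (1 - s - 1) = -s * (-s + 1) := by ring
    rw [e]
    linarith
  have h3 : 1 - q ^ (1 - s - 1) * x * -1 = (q ^ s + x) / q ^ s := by
    have := zpow_ne_zero s hq0
    rw [show (1 : ℤ) - s - 1 = -s by ring, zpow_neg]
    field_simp
    ring
  rw [h2, h3, zpow_sub₀ hq0, neg_one_mul, neg_neg, one_zpow, one_mul,
    div_div_div_cancel_right₀ (zpow_ne_zero s hq0)]

/-- |q^s| exceeds 2|x| for very negative s and is below |x|/2 for large s, so only finitely many s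
matter. The factor 2 leaves a margin ε when x is moved within a ball of radius ε. -/
lemma exists_pos_le_norm_zpow_add {q x : ℂ} (hq0 : q ≠ 0) (hq : ‖q‖ < 1) (hx : x ≠ 0)
    (F : Finset ℤ) (hF : ∀ s ∉ F, q ^ s + x ≠ 0) :
    ∃ ε : ℝ, 0 < ε ∧ ∀ s ∉ F, 2 * ε ≤ ‖q ^ s + x‖ := by
  have hp : 0 < ‖q‖ := norm_pos_iff.2 hq0
  have hx' : 0 < ‖x‖ := norm_pos_iff.2 hx
  obtain ⟨K, hK⟩ := exists_pow_lt_of_lt_one (half_pos hx') hq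
  obtain ⟨K', hK'⟩ := exists_pow_lt_of_lt_one (show 0 < (2 * ‖x‖)⁻¹ by positivity) hq
  have h1 : ∀ᶠ ε : ℝ in 𝓝[>] 0, ∀ s ∈ Finset.Ioo (-K' : ℤ) K \ F, 2 * ε ≤ ‖q ^ s + x‖ := by
    refine (eventually_all_finset _).2 fun s hs => ?_
    have : 0 < ‖q ^ s + x‖ / 2 := half_pos (norm_pos_iff.2 (hF s (Finset.mem_sdiff.1 hs).2))
    filter_upwards [mem_nhdsWithin_of_mem_nhds (Iio_mem_nhds this)] with ε hε
    have : ε < ‖q ^ s + x‖ / 2 := hε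
    linarith
  have h2 : ∀ᶠ ε : ℝ in 𝓝[>] 0, ε < ‖x‖ / 4 :=
    mem_nhdsWithin_of_mem_nhds (Iio_mem_nhds (by positivity))
  obtain ⟨ε, h1, h2, h3⟩ := (h1.and (h2.and self_mem_nhdsWithin)).exists
  refine ⟨ε, h3, fun s hs => ?_⟩
  by_cases hs' : s ∈ Finset.Ioo (-K' : ℤ) K
  · exact h1 s (Finset.mem_sdiff.2 ⟨hs', hs⟩)
  rw [Finset.mem_Ioo, not_and_or, not_lt, not_lt] at hs'
  rcases hs' with h | h
  · have e1 : ‖q‖ ^ (-K' : ℤ) ≤ ‖q ^ s‖ := by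
      rw [norm_zpow]; exact zpow_le_zpow_right_of_le_one₀ hp hq.le h
    rw [zpow_neg, zpow_natCast] at e1
    have e2 : 2 * ‖x‖ < (‖q‖ ^ K')⁻¹ := by
      rw [lt_inv_comm₀ (by positivity) (by positivity)]; exact hK'
    have e3 := norm_sub_norm_le (q ^ s) (-x)
    rw [norm_neg, sub_neg_eq_add] at e3
    linarith
  · have e1 : ‖q ^ s‖ ≤ ‖q‖ ^ (K : ℤ) := by
      rw [norm_zpow]; exact zpow_le_zpow_right_of_le_one₀ hp hq.le h
    rw [zpow_natCast] at e1
    have e3 := norm_sub_norm_le x (-q ^ s)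
    rw [norm_neg, sub_neg_eq_add, add_comm] at e3
    linarith

lemma norm_triangle_div_le {q x : ℂ} {ε : ℝ} (hε : 0 < ε) (s : ℤ) (h : ε ≤ ‖q ^ s + x‖) :
    ‖q ^ (s * (s + 1) / 2) / (q ^ s + x)‖ ≤ ‖q ^ (s * (s + 1) / 2)‖ * ε⁻¹ := by
  rw [norm_div, div_eq_mul_inv]
  gcongr

lemma summable_lerchSum {q x : ℂ} (hq0 : q ≠ 0) (hq : ‖q‖ < 1) (hx : x ≠ 0)
    (h : ∀ s : ℤ, q ^ s + x ≠ 0) :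
    Summable fun s : ℤ => q ^ (s * (s + 1) / 2) / (q ^ s + x) := by
  obtain ⟨ε, hε, H⟩ := exists_pos_le_norm_zpow_add hq0 hq hx ∅ fun s _ => h s
  exact Summable.of_norm_bounded ((summable_norm_triangle hq0 hq).mul_right (2 * ε)⁻¹)
    fun s => norm_triangle_div_le (by positivity) s (H s (Finset.notMem_empty s))

/-- Omitting the indices in F allows a polar term to be split off from an analytic remainder. -/
lemma differentiableAt_lerchSum_sdiff {q x : ℂ} (hq0 : q ≠ 0) (hq : ‖q‖ < 1) (hx : x ≠ 0)
    (F : Finset ℤ) (hF : ∀ s ∉ F, q ^ s + x ≠ 0) :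
    DifferentiableAt ℂ
      (fun y => ∑' s : ℤ, if s ∈ F then 0 else q ^ (s * (s + 1) / 2) / (q ^ s + y)) x := by
  obtain ⟨ε, hε, H⟩ := exists_pos_le_norm_zpow_add hq0 hq hx F hF
  have H' : ∀ s ∉ F, ∀ y ∈ Metric.ball x ε, ε ≤ ‖q ^ s + y‖ := by
    intro s hs y hy
    rw [Metric.mem_ball, dist_eq_norm, norm_sub_rev] at hy
    have h1 := H s hs
    have h2 := norm_add_le (q ^ s + y) (x - y)
    rw [show q ^ s + y + (x - y) = q ^ s + x by ring] at h2
    linarith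
  refine (Complex.differentiableOn_tsum_of_summable_norm
    ((summable_norm_triangle hq0 hq).mul_right ε⁻¹) (fun s => ?_) Metric.isOpen_ball
    fun s y hy => ?_).differentiableAt (Metric.ball_mem_nhds x hε)
  · by_cases hs : s ∈ F
    · simpa only [if_pos hs] using differentiableOn_const _
    · simp only [if_neg hs]
      intro y hy
      refine ((differentiableAt_const _).div ((differentiableAt_const _).add differentiableAt_id)
        ?_).differentiableWithinAt
      exact norm_pos_iff.1 (hε.trans_le (H' s hs y hy))
  · split_ifs with hs
    · rw [norm_zero]; positivity
    · exact norm_triangle_div_le hε s (H' s hs y hy)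

lemma differentiableAt_lerchSum {q x : ℂ} (hq0 : q ≠ 0) (hq : ‖q‖ < 1) (hx : x ≠ 0)
    (h : ∀ s : ℤ, q ^ s + x ≠ 0) : DifferentiableAt ℂ (fun y => lerchSum y q) x := by
  simpa [lerchSum] using differentiableAt_lerchSum_sdiff hq0 hq hx ∅ fun s _ => h s

lemma norm_zpow_ne_one {q : ℂ} (hq : ‖q‖ < 1) {s : ℤ} (hs : s ≠ 0) :
    ‖q ^ s‖ ≠ 1 := by
  rw [norm_zpow]
  exact fun h => hs ((zpow_eq_one_iff_right₀ (norm_nonneg q) hq.ne).1 h)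

/-- Only the term s = 0, equal to 1/(1 + x), is singular at -1. -/
lemma tendsto_lerchSum_neg_one {q : ℂ} (hq0 : q ≠ 0) (hq : ‖q‖ < 1) :
    Tendsto (fun x => (1 + x) * lerchSum x q) (𝓝[≠] (-1)) (𝓝 1) := by
  have hF : ∀ s ∉ ({0} : Finset ℤ), q ^ s + (-1) ≠ 0 := by
    intro s hs h
    refine norm_zpow_ne_one hq (s := s) (by simpa using hs) ?_
    rw [eq_neg_of_add_eq_zero_left h]; simp
  obtain ⟨ε, hε, H⟩ := exists_pos_le_norm_zpow_add hq0 hq (neg_ne_zero.2 one_ne_zero) {0} hF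
  have hc := (differentiableAt_lerchSum_sdiff hq0 hq (neg_ne_zero.2 one_ne_zero) {0}
    hF).continuousAt.tendsto
  have h1 : Tendsto (fun x : ℂ => 1 + x) (𝓝[≠] (-1)) (𝓝 0) := by
    have : Tendsto (fun x : ℂ => 1 + x) (𝓝 (-1)) (𝓝 (1 + -1)) := tendsto_id.const_add 1
    rw [add_neg_cancel] at this
    exact this.mono_left nhdsWithin_le_nhds
  have h2 := (h1.mul (hc.mono_left nhdsWithin_le_nhds)).const_add 1
  rw [zero_mul, add_zero] at h2
  refine h2.congr' ?_
  filter_upwards [self_mem_nhdsWithin, mem_nhdsWithin_of_mem_nhds (Metric.ball_mem_nhds (-1 : ℂ) hε),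
    mem_nhdsWithin_of_mem_nhds (Metric.ball_mem_nhds (-1 : ℂ) one_pos)] with x hx hb hb1
  rw [Metric.mem_ball, dist_eq_norm, norm_sub_rev] at hb
  have hx1 : 1 + x ≠ 0 := fun h => hx (by
    rw [Set.mem_singleton_iff]; linear_combination h)
  have hx0 : x ≠ 0 := by rintro rfl; simp at hb1
  have hs : ∀ s : ℤ, q ^ s + x ≠ 0 := by
    intro s h
    by_cases hs : s = 0
    · subst hs; exact hx1 (by simpa using h)
    · have h3 := H s (by simpa using hs)
      rw [show q ^ s + -1 = -1 - x by linear_combination h] at h3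
      linarith
  have h4 := (summable_lerchSum hq0 hq hx0 hs).tsum_eq_add_tsum_ite 0
  rw [lerchSum, h4]
  simp only [Finset.mem_singleton, zero_mul, EuclideanDomain.zero_div, zpow_zero]
  rw [mul_add, mul_one_div_cancel hx1]

/-- After s ↦ s + 1 each term carries q^s/(q^s + x) = 1 - x/(q^s + x), and the 1 sums to j(-1;q) by
`tsum_triangle`. -/
lemma lerchSum_q_mul {q x : ℂ} (hq0 : q ≠ 0) (hq : ‖q‖ < 1) (hx : x ≠ 0)
    (h : ∀ s : ℤ, q ^ s + x ≠ 0) :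
    lerchSum (q * x) q = jTheta (-1) q - x * lerchSum x q := by
  rw [← tsum_triangle hq0 hq, lerchSum, lerchSum, ← tsum_mul_left,
    ← (summable_norm_triangle hq0 hq).of_norm.tsum_sub
      ((summable_lerchSum hq0 hq hx h).mul_left x), ← (Equiv.addRight (1 : ℤ)).tsum_eq]
  refine tsum_congr fun s => ?_
  have e : (s + 1) * (s + 1 + 1) / 2 = s * (s + 1) / 2 + (s + 1) := by
    have h1 := two_mul_triangle s
    have h2 := two_mul_triangle (s + 1)
    linarith
  rw [Equiv.coe_addRight, e, zpow_add₀ hq0, zpow_add_one₀ hq0]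
  have := h s
  have h3 : q ^ s * q + q * x ≠ 0 := by
    rw [mul_comm, ← mul_add]; exact mul_ne_zero hq0 this
  field_simp
  ring

/-! ### q-periodic functions on the punctured plane -/

lemma zpow_mul_iff {q : ℂ} (hq0 : q ≠ 0) {P : ℂ → Prop}
    (hP : ∀ a, a ≠ 0 → (P (q * a) ↔ P a)) {a : ℂ} (ha : a ≠ 0) (k : ℤ) :
    P (q ^ k * a) ↔ P a := by
  induction k with
  | zero => simp
  | succ n ih =>
    rw [← ih, ← hP _ (mul_ne_zero (zpow_ne_zero (n : ℤ) hq0) ha), ← mul_assoc,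
      ← zpow_one_add₀ hq0, add_comm]
  | pred n ih =>
    rw [← ih, ← hP _ (mul_ne_zero (zpow_ne_zero (-n - 1 : ℤ) hq0) ha), ← mul_assoc,
      ← zpow_one_add₀ hq0]
    ring_nf

lemma of_fundamental_annulus {q : ℂ} (hq0 : q ≠ 0) (hq : ‖q‖ < 1) {P : ℂ → Prop}
    (hP : ∀ a, a ≠ 0 → (P (q * a) ↔ P a)) (h : ∀ a, ‖q‖ < ‖a‖ → ‖a‖ ≤ 1 → P a)
    {a : ℂ} (ha : a ≠ 0) : P a := by
  have hp : 0 < ‖q‖ := norm_pos_iff.2 hq0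
  -- The base must exceed 1, hence |q|⁻¹. The point moved into the annulus is q^{n+1} a.
  obtain ⟨n, h1, h2⟩ := exists_mem_Ioc_zpow (norm_pos_iff.2 ha) (one_lt_inv_iff₀.2 ⟨hp, hq⟩)
  rw [inv_zpow'] at h1 h2
  have e : ‖q‖ ^ (-(n + 1)) = (‖q‖ ^ (n + 1))⁻¹ := zpow_neg _ _
  have e' : ‖q‖ ^ (-n) = ‖q‖ * (‖q‖ ^ (n + 1))⁻¹ := by
    rw [← e, ← zpow_one_add₀ hp.ne']; ring_nf
  have hpos : 0 < ‖q‖ ^ (n + 1) := zpow_pos hp _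
  rw [e'] at h1
  rw [e] at h2
  refine (zpow_mul_iff hq0 hP ha (n + 1)).1 (h _ ?_ ?_) <;> rw [norm_mul, norm_zpow]
  · calc ‖q‖ = ‖q‖ ^ (n + 1) * (‖q‖ * (‖q‖ ^ (n + 1))⁻¹) := by field_simp
      _ < _ := by gcongr
  · calc _ ≤ ‖q‖ ^ (n + 1) * (‖q‖ ^ (n + 1))⁻¹ := by gcongr
      _ = 1 := by field_simp

/-- `h` agrees near `a`, away from `a`, with a function analytic at `a`. -/
def RemovableAt (h : ℂ → ℂ) (a : ℂ) : Prop :=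
  ∃ g, AnalyticAt ℂ g a ∧ h =ᶠ[𝓝[≠] a] g

/-- Riemann's removable singularity theorem. The arbitrary value h p is harmless, since (z - p) h p
→ 0. -/
lemma removableAt_of_tendsto {h : ℂ → ℂ} {p : ℂ}
    (hd : ∀ᶠ z in 𝓝[≠] p, DifferentiableAt ℂ h z)
    (hl : Tendsto (fun z => (z - p) * h z) (𝓝[≠] p) (𝓝 0)) : RemovableAt h p := by
  have ho : (fun z => h z - h p) =o[𝓝[≠] p] fun z => (z - p)⁻¹ := by
    refine Asymptotics.isLittleO_of_tendsto' ?_ ?_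
    · filter_upwards [self_mem_nhdsWithin] with z hz h0
      exact absurd (inv_eq_zero.1 h0) (sub_ne_zero.2 hz)
    · have h1 : Tendsto (fun z => (z - p) * h p) (𝓝[≠] p) (𝓝 0) := by
        have : ContinuousAt (fun z => (z - p) * h p) p := by fun_prop
        simpa using this.tendsto.mono_left (nhdsWithin_le_nhds (s := {p}ᶜ))
      refine ((hl.sub h1).congr fun z => ?_).trans (by simp)
      rw [div_inv_eq_mul]; ring
  have hD := Complex.differentiableOn_update_limUnder_insert_of_isLittleO hd
    (fun z (hz : DifferentiableAt ℂ h z) => hz.differentiableWithinAt) ho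
  refine ⟨_, hD.analyticAt (insert_mem_nhds_iff.2 hd), ?_⟩
  filter_upwards [self_mem_nhdsWithin] with z hz
  exact (Function.update_of_ne hz _ _).symm

lemma tendsto_const_mul_punctured {c : ℂ} (hc : c ≠ 0) (a : ℂ) :
    Tendsto (fun x => c * x) (𝓝[≠] a) (𝓝[≠] (c * a)) := by
  refine tendsto_nhdsWithin_iff.2 ⟨?_, ?_⟩
  · exact ((continuous_const_mul c).tendsto a).mono_left nhdsWithin_le_nhds
  · filter_upwards [self_mem_nhdsWithin] with x hx h
    exact hx (mul_left_cancel₀ hc h)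

lemma removableAt_q_mul_iff {q : ℂ} (hq0 : q ≠ 0) {h : ℂ → ℂ} {a : ℂ}
    (hper : ∀ᶠ x in 𝓝[≠] a, h (q * x) = h x) : RemovableAt h (q * a) ↔ RemovableAt h a := by
  constructor
  · rintro ⟨g, hg, he⟩
    refine ⟨fun x => g (q * x), hg.comp (analyticAt_const.mul analyticAt_id), ?_⟩
    filter_upwards [hper, (tendsto_const_mul_punctured hq0 a).eventually he] with x h1 h2
    rw [← h1, h2]
  · rintro ⟨g, hg, he⟩
    have e : q⁻¹ * (q * a) = a := by field_simp
    refine ⟨fun x => g (q⁻¹ * x), ?_, ?_⟩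
    · refine AnalyticAt.comp (g := g) (f := fun x => q⁻¹ * x) ?_
        (analyticAt_const.mul analyticAt_id)
      rwa [e]
    · have ht := tendsto_const_mul_punctured (inv_ne_zero hq0) (q * a)
      rw [e] at ht
      filter_upwards [ht.eventually he, ht.eventually hper] with x h1 h2
      rw [← h1, ← h2, mul_inv_cancel_left₀ hq0]

/-- A `q`-periodic function on `ℂ \ {0}` with only removable singularities is constant. -/
lemma exists_eventuallyEq_const {q : ℂ} (hq0 : q ≠ 0) (hq : ‖q‖ < 1) {h : ℂ → ℂ}
    (hloc : ∀ a, ‖q‖ < ‖a‖ → ‖a‖ ≤ 1 → RemovableAt h a)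
    (hper : ∀ a, a ≠ 0 → ∀ᶠ x in 𝓝[≠] a, h (q * x) = h x) :
    ∃ c, ∀ a, a ≠ 0 → h =ᶠ[𝓝[≠] a] fun _ => c := by
  have hrem : ∀ a, a ≠ 0 → RemovableAt h a := fun a ha =>
    of_fundamental_annulus hq0 hq (fun a ha => removableAt_q_mul_iff hq0 (hper a ha)) hloc ha
  -- Taking punctured limits everywhere removes all singularities at once: near each nonzero point H
  -- coincides with the local analytic extension.
  let H : ℂ → ℂ := fun a => limUnder (𝓝[≠] a) h
  have key : ∀ a, a ≠ 0 → AnalyticAt ℂ H a ∧ h =ᶠ[𝓝[≠] a] H := by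
    intro a ha
    obtain ⟨g, hg, he⟩ := hrem a ha
    have h1 : ∀ᶠ b in 𝓝 a, ∀ᶠ x in 𝓝[≠] b, h x = g x := by
      have h2 := eventually_eventually_nhdsWithin.2 he
      rw [eventually_nhdsWithin_iff] at h2
      filter_upwards [h2] with b hb
      by_cases hba : b = a
      · subst hba; exact he
      · have h3 := hb hba
        rw [(isOpen_compl_singleton (x := a)).nhdsWithin_eq hba] at h3
        exact h3.filter_mono nhdsWithin_le_nhds
    have hH : H =ᶠ[𝓝 a] g := by
      filter_upwards [h1, hg.eventually_analyticAt] with b hb hgb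
      refine Tendsto.limUnder_eq ?_
      exact (hgb.continuousAt.tendsto.mono_left nhdsWithin_le_nhds).congr'
        (hb.mono fun x hx => hx.symm)
    exact ⟨hg.congr hH.symm, he.trans (hH.symm.filter_mono nhdsWithin_le_nhds)⟩
  have hHper : ∀ a, a ≠ 0 → H (q * a) = H a := by
    intro a ha
    have h1 : Tendsto (fun x => H (q * x)) (𝓝[≠] a) (𝓝 (H (q * a))) :=
      ((key _ (mul_ne_zero hq0 ha)).1.continuousAt.tendsto.mono_left nhdsWithin_le_nhds).comp
        (tendsto_const_mul_punctured hq0 a)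
    refine tendsto_nhds_unique h1
      (((key a ha).1.continuousAt.tendsto.mono_left nhdsWithin_le_nhds).congr' ?_)
    filter_upwards [hper a ha, (key a ha).2, (tendsto_const_mul_punctured hq0 a).eventually
      (key _ (mul_ne_zero hq0 ha)).2] with x h1 h2 h3
    rw [← h2, ← h1, h3]
  have hp : 0 < ‖q‖ := norm_pos_iff.2 hq0
  obtain ⟨M, hM⟩ : ∃ M, ∀ a, a ≠ 0 → ‖H a‖ ≤ M := by
    have hK : IsCompact (Metric.closedBall (0 : ℂ) 1 ∩ {a | ‖q‖ ≤ ‖a‖}) :=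
      (isCompact_closedBall _ _).inter_right (isClosed_le continuous_const continuous_norm)
    obtain ⟨M, hM⟩ := hK.exists_bound_of_continuousOn (f := H) fun a ha =>
      (key a (norm_pos_iff.1 (hp.trans_le ha.2))).1.continuousAt.continuousWithinAt
    refine ⟨M, fun a ha => of_fundamental_annulus hq0 hq (P := fun a => ‖H a‖ ≤ M)
      (fun a ha => by rw [hHper a ha]) (fun a h1 h2 => hM a ⟨by simpa using h2, h1.le⟩) ha⟩
  -- H is bounded by its maximum on the closed annulus, so it extends across 0 to a bounded entire
  -- function and Liouville applies.
  have hD := Complex.differentiableOn_update_limUnder_of_bddAbove (f := H) (c := 0)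
    (s := Set.univ) univ_mem
    (fun a ha => (key a ha.2).1.differentiableAt.differentiableWithinAt)
    ⟨M, by rintro _ ⟨a, ha, rfl⟩; exact hM a ha.2⟩
  set G := Function.update H 0 (limUnder (𝓝[≠] 0) H) with hG
  have hGb : Bornology.IsBounded (Set.range G) := by
    rw [isBounded_iff_forall_norm_le]
    refine ⟨max M ‖G 0‖, ?_⟩
    rintro _ ⟨a, rfl⟩
    by_cases ha : a = 0
    · subst ha; exact le_max_right _ _
    · rw [hG, Function.update_of_ne ha]; exact (hM a ha).trans (le_max_left _ _)
  refine ⟨G 0, fun a ha => (key a ha).2.trans ?_⟩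
  filter_upwards [mem_nhdsWithin_of_mem_nhds (isOpen_ne.mem_nhds ha)] with x hx
  rw [← (differentiableOn_univ.1 hD).apply_eq_apply_of_bounded hGb x 0, hG,
    Function.update_of_ne hx]

/-! ### The q-hypergeometric series -/

/-- The `n`-th term of the series `∑ (-aq,-q/a;q)_n q^{n+1} / (q;q²)_{n+1}`. -/
noncomputable def mockTerm (q a : ℂ) (n : ℕ) : ℂ :=
  qPoch (-a * q) q n * qPoch (-q / a) q n * q ^ (n + 1) / qPoch q (q ^ 2) (n + 1)

lemma norm_qPoch_le {q x : ℂ} (hq : ‖q‖ < 1) {R : ℝ} (hx : ‖x‖ ≤ R) (n : ℕ) :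
    ‖qPoch x q n‖ ≤ Real.exp ((1 - ‖q‖)⁻¹ * R) := by
  have hR : 0 ≤ R := (norm_nonneg x).trans hx
  rw [qPoch, norm_prod]
  calc ∏ i ∈ Finset.range n, ‖1 - q ^ i * x‖
      ≤ ∏ i ∈ Finset.range n, Real.exp (‖q‖ ^ i * R) := by
        refine Finset.prod_le_prod (fun _ _ => norm_nonneg _) fun i _ => ?_
        calc ‖1 - q ^ i * x‖ ≤ 1 + ‖q‖ ^ i * ‖x‖ := by
              simpa using norm_sub_le 1 (q ^ i * x)
          _ ≤ ‖q‖ ^ i * R + 1 := by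
              rw [add_comm]; gcongr
          _ ≤ _ := Real.add_one_le_exp _
    _ = Real.exp ((∑ i ∈ Finset.range n, ‖q‖ ^ i) * R) := by
        rw [← Real.exp_sum, Finset.sum_mul]
    _ ≤ _ := by
        gcongr
        rw [← tsum_geometric_of_lt_one (norm_nonneg q) hq]
        exact (summable_geometric_of_lt_one (norm_nonneg q) hq).sum_le_tsum _
          fun _ _ => by positivity

/-- Uniformity in a over an annulus gives both summability and analyticity of the sum. -/
lemma exists_norm_mockTerm_le {q : ℂ} (hq : ‖q‖ < 1) {r R : ℝ} (hr : 0 < r) :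
    ∃ C : ℝ, ∀ a : ℂ, r ≤ ‖a‖ → ‖a‖ ≤ R → ∀ n, ‖mockTerm q a n‖ ≤ C * ‖q‖ ^ n := by
  have hq2 := norm_pow_lt_one hq two_ne_zero
  obtain ⟨M, hM0, hM⟩ := exists_norm_le_of_tendsto
    ((tendsto_qPoch hq2 q).inv₀ (qPochInf_ne_zero_of_norm_lt hq2 hq))
  refine ⟨Real.exp ((1 - ‖q‖)⁻¹ * R) * Real.exp ((1 - ‖q‖)⁻¹ * r⁻¹) * M, fun a h1 h2 n => ?_⟩
  have ha : 0 < ‖a‖ := hr.trans_le h1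
  rw [mockTerm, div_eq_mul_inv, norm_mul, norm_mul, norm_mul]
  have e1 : ‖qPoch (-a * q) q n‖ ≤ Real.exp ((1 - ‖q‖)⁻¹ * R) := by
    refine norm_qPoch_le hq ?_ n
    rw [norm_mul, norm_neg]
    exact (mul_le_of_le_one_right (norm_nonneg a) hq.le).trans h2
  have e2 : ‖qPoch (-q / a) q n‖ ≤ Real.exp ((1 - ‖q‖)⁻¹ * r⁻¹) := by
    refine norm_qPoch_le hq ?_ n
    rw [norm_div, norm_neg, inv_eq_one_div]
    gcongr
  have e3 : ‖q ^ (n + 1)‖ ≤ ‖q‖ ^ n := by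
    rw [norm_pow]; exact pow_le_pow_of_le_one (norm_nonneg q) hq.le (Nat.le_succ n)
  have e4 := hM (n + 1)
  calc _ ≤ Real.exp ((1 - ‖q‖)⁻¹ * R) * Real.exp ((1 - ‖q‖)⁻¹ * r⁻¹) * ‖q‖ ^ n * M := by
        gcongr
    _ = _ := by ring

lemma summable_mockTerm {q a : ℂ} (hq : ‖q‖ < 1) (ha : a ≠ 0) : Summable (mockTerm q a) := by
  obtain ⟨C, hC⟩ := exists_norm_mockTerm_le (R := ‖a‖) hq (norm_pos_iff.2 ha)
  exact Summable.of_norm_bounded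
    ((summable_geometric_of_lt_one (norm_nonneg q) hq).mul_left C) (hC a le_rfl le_rfl)

lemma differentiableAt_tsum_mockTerm {q a : ℂ} (hq : ‖q‖ < 1) (ha : a ≠ 0) :
    DifferentiableAt ℂ (fun x => ∑' n, mockTerm q x n) a := by
  have hp := norm_pos_iff.2 ha
  obtain ⟨C, hC⟩ := exists_norm_mockTerm_le (r := ‖a‖ / 2) (R := 2 * ‖a‖) hq (half_pos hp)
  have hb : ∀ x ∈ Metric.ball a (‖a‖ / 2), ‖a‖ / 2 ≤ ‖x‖ ∧ ‖x‖ ≤ 2 * ‖a‖ := by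
    intro x hx
    rw [Metric.mem_ball, dist_eq_norm] at hx
    have h1 := norm_sub_norm_le x a
    have h2 := norm_sub_norm_le a x
    rw [norm_sub_rev] at h2
    constructor <;> linarith
  refine (Complex.differentiableOn_tsum_of_summable_norm
    ((summable_geometric_of_lt_one (norm_nonneg q) hq).mul_left C) (fun n x hx => ?_)
    Metric.isOpen_ball fun n x hx => hC x (hb x hx).1 (hb x hx).2 n).differentiableAt
    (Metric.ball_mem_nhds a (half_pos hp))
  have hx0 : x ≠ 0 := norm_pos_iff.1 ((half_pos hp).trans_le (hb x hx).1)
  refine DifferentiableAt.differentiableWithinAt ?_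
  unfold mockTerm qPoch
  fun_prop (disch := assumption)

/-- The combination telescopes. The prefactor 1 + 1/a completes (-q/a;q)_n to (-1/a;q)_{n+1}, and 1
+ 1/(qa) likewise supplies the factor 1 + aq missing from (-aq²;q)_n. -/
lemma tsum_mockTerm_q_mul {q a : ℂ} (hq0 : q ≠ 0) (hq : ‖q‖ < 1) (ha : a ≠ 0) :
    (1 + 1 / (q * a)) * ∑' n, mockTerm q (q * a) n + a * ((1 + 1 / a) * ∑' n, mockTerm q a n) =
      qPochInf (-a * q) q * qPochInf (-1 / a) q / qPochInf q (q ^ 2) - 1 := by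
  have hq2 := norm_pow_lt_one hq two_ne_zero
  let P : ℕ → ℂ := fun n => qPoch (-a * q) q n * qPoch (-1 / a) q n / qPoch q (q ^ 2) n
  have hs1 := (summable_mockTerm hq (mul_ne_zero hq0 ha)).mul_left (1 + 1 / (q * a))
  have hs2 := ((summable_mockTerm hq ha).mul_left (1 + 1 / a)).mul_left a
  rw [← tsum_mul_left, ← tsum_mul_left, ← tsum_mul_left, ← hs1.tsum_add hs2]
  have hterm : ∀ n, (1 + 1 / (q * a)) * mockTerm q (q * a) n +
      a * ((1 + 1 / a) * mockTerm q a n) = P (n + 1) - P n := by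
    intro n
    have e1 : (1 + 1 / a) * qPoch (-q / a) q n = qPoch (-1 / a) q n * (1 + q ^ n / a) := by
      have h1 := qPoch_succ (-1 / a) q n
      rw [qPoch_succ', show q * (-1 / a) = -q / a by ring] at h1
      linear_combination h1
    have e2 : (1 + 1 / (q * a)) * qPoch (-(q * a) * q) q n =
        1 / (q * a) * qPoch (-a * q) q n * (1 + q ^ n * a * q) := by
      have h1 := qPoch_succ (-a * q) q n
      rw [qPoch_succ', show q * (-a * q) = -(q * a) * q by ring] at h1
      have h2 : (1 : ℂ) + 1 / (q * a) = 1 / (q * a) * (1 + a * q) := by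
        field_simp; ring
      rw [h2]
      linear_combination 1 / (q * a) * h1
    have e3 : -q / (q * a) = -1 / a := by field_simp
    have hO := qPoch_ne_zero_of_norm_lt hq2 hq n
    have hO1 := qPoch_ne_zero_of_norm_lt hq2 hq (n + 1)
    have e4 := qPoch_succ q (q ^ 2) n
    have hO2 : 1 - (q ^ 2) ^ n * q ≠ 0 := by
      rw [e4] at hO1; exact right_ne_zero_of_mul hO1
    calc _ = ((1 + 1 / (q * a)) * qPoch (-(q * a) * q) q n * qPoch (-1 / a) q n * q ^ (n + 1) +
          a * qPoch (-a * q) q n * ((1 + 1 / a) * qPoch (-q / a) q n) * q ^ (n + 1)) /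
            qPoch q (q ^ 2) (n + 1) := by
          rw [mockTerm, mockTerm, e3]; ring
      _ = _ := by
          simp only [P]
          rw [e1, e2, e4, qPoch_succ, qPoch_succ, pow_succ]
          rw [show (q ^ 2) ^ n = (q ^ n) ^ 2 by ring] at hO2 ⊢
          generalize qPoch (-a * q) q n = u
          generalize qPoch (-1 / a) q n = v
          generalize qPoch q (q ^ 2) n = w at *
          -- With q^n as a free variable, the telescoping step is a rational identity.
          generalize q ^ n = x at *
          rw [mul_comm (x ^ 2) q] at hO2 ⊢
          field_simp
          ring
  have hP : Tendsto P atTop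
      (𝓝 (qPochInf (-a * q) q * qPochInf (-1 / a) q / qPochInf q (q ^ 2))) :=
    ((tendsto_qPoch hq _).mul (tendsto_qPoch hq _)).div (tendsto_qPoch hq2 _)
      (qPochInf_ne_zero_of_norm_lt hq2 hq)
  have hlim := (hs1.add hs2).hasSum.tendsto_sum_nat
  refine tendsto_nhds_unique hlim ((hP.sub_const 1).congr fun n => ?_)
  rw [Finset.sum_congr rfl fun n _ => hterm n, Finset.sum_range_sub]
  simp [P, qPoch]

/-! ### The defect and its functional equation -/

/-- The points away from the singularities of both sides of the identity. -/
def Regular (q a : ℂ) : Prop :=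
  a ≠ 0 ∧ ∀ k : ℤ, a ^ 4 ≠ q ^ (4 * k)

/-- The difference of the two sides of the identity, with `m(x,q,-1)` written as a `lerchSum`. -/
noncomputable def defect (q a : ℂ) : ℂ :=
  (1 + 1 / a) * ∑' n, mockTerm q a n + lerchSum a q / jTheta (-1) q
    - jTheta (-a) q / J₂ q 1 2 * (lerchSum (a ^ 2) (q ^ 2) / jTheta (-1) (q ^ 2))
    + a * (J₁ q 4 ^ 3 / J₁ q 2 ^ 3)
      * (jTheta a q * jTheta (q * a ^ 2) (q ^ 2) / jTheta (a ^ 4) (q ^ 4))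

section
variable {q : ℂ}

lemma jTheta_neg_one_ne_zero (hq : ‖q‖ < 1) : jTheta (-1) q ≠ 0 := by
  rw [jTheta_neg_one hq]
  exact mul_ne_zero (mul_ne_zero two_ne_zero
    (pow_ne_zero _ (qPochInf_ne_zero_of_norm_lt hq (by rwa [norm_neg]))))
    (qPochInf_ne_zero_of_norm_lt hq hq)

lemma Regular.zpow_add_ne_zero {a : ℂ} (h : Regular q a) (s : ℤ) : q ^ s + a ≠ 0 := by
  intro h0
  refine h.2 s ?_
  rw [eq_neg_of_add_eq_zero_right h0, mul_comm, zpow_mul, Even.neg_pow (by decide)]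
  rfl

lemma Regular.sq_zpow_add_ne_zero {a : ℂ} (h : Regular q a) (s : ℤ) :
    (q ^ 2) ^ s + a ^ 2 ≠ 0 := by
  intro h0
  refine h.2 s ?_
  have e : a ^ 4 = (a ^ 2) ^ 2 := by ring
  have e2 : ((q ^ 2) ^ s) ^ 2 = q ^ (4 * s) := by
    rw [← zpow_natCast q 2, ← zpow_mul, ← zpow_natCast, ← zpow_mul]; congr 1; push_cast; ring
  rw [e, eq_neg_of_add_eq_zero_right h0, neg_sq, e2]

lemma Regular.ne_zpow {a : ℂ} (h : Regular q a) (s : ℤ) : a ≠ q ^ s := by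
  rintro rfl
  exact h.2 s (by rw [mul_comm, zpow_mul]; rfl)

lemma Regular.jTheta_ne_zero {a : ℂ} (hq0 : q ≠ 0) (hq : ‖q‖ < 1) (h : Regular q a) :
    jTheta a q ≠ 0 :=
  AppellLerch.jTheta_ne_zero hq hq0 h.1 h.ne_zpow

lemma jTheta_zpow (hq0 : q ≠ 0) (hq : ‖q‖ < 1) (k : ℤ) : jTheta (q ^ k) q = 0 := by
  have h := zpow_mul_iff hq0 (P := fun x => jTheta x q = 0) (fun a ha => by
    rw [jTheta_q_mul hq hq0 ha]; simp [ha]) one_ne_zero k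
  rw [mul_one] at h
  exact h.2 (jTheta_one q hq)

lemma regular_iff (hq0 : q ≠ 0) (hq : ‖q‖ < 1) (a : ℂ) :
    Regular q a ↔ a ≠ 0 ∧ jTheta (a ^ 4) (q ^ 4) ≠ 0 := by
  have hq4 := norm_pow_lt_one hq four_ne_zero
  have e : ∀ k : ℤ, (q ^ 4) ^ k = q ^ (4 * k) := fun k => by rw [zpow_mul]; rfl
  refine and_congr_right fun ha => ⟨fun h => ?_, fun h k hk => ?_⟩
  · exact AppellLerch.jTheta_ne_zero hq4 (pow_ne_zero _ hq0) (pow_ne_zero _ ha)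
      fun k => by rw [e]; exact h k
  · rw [hk, ← e] at h
    exact h (jTheta_zpow (pow_ne_zero _ hq0) hq4 k)

lemma differentiableAt_defect (hq0 : q ≠ 0) (hq : ‖q‖ < 1) {a : ℂ} (h : Regular q a) :
    DifferentiableAt ℂ (defect q) a := by
  have ha := h.1
  have hq2 := norm_pow_lt_one hq two_ne_zero
  have hq4 := norm_pow_lt_one hq four_ne_zero
  have d1 := differentiableAt_tsum_mockTerm hq ha
  have d2 := differentiableAt_lerchSum hq0 hq ha h.zpow_add_ne_zero
  have d3 : DifferentiableAt ℂ (fun x => lerchSum (x ^ 2) (q ^ 2)) a :=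
    (differentiableAt_lerchSum (pow_ne_zero 2 hq0) hq2 (pow_ne_zero 2 ha)
      h.sq_zpow_add_ne_zero).comp a (f := fun x => x ^ 2) (by fun_prop)
  have d4 : DifferentiableAt ℂ (fun x => jTheta (-x) q) a :=
    (differentiableAt_jTheta hq (neg_ne_zero.2 ha)).comp a (f := fun x => -x) (by fun_prop)
  have d5 := differentiableAt_jTheta hq ha
  have d6 : DifferentiableAt ℂ (fun x => jTheta (q * x ^ 2) (q ^ 2)) a :=
    (differentiableAt_jTheta hq2 (mul_ne_zero hq0 (pow_ne_zero 2 ha))).comp a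
      (f := fun x => q * x ^ 2) (by fun_prop)
  have d7 : DifferentiableAt ℂ (fun x => jTheta (x ^ 4) (q ^ 4)) a :=
    (differentiableAt_jTheta hq4 (pow_ne_zero 4 ha)).comp a (f := fun x => x ^ 4) (by fun_prop)
  have h7 := ((regular_iff hq0 hq a).1 h).2
  have d0 : DifferentiableAt ℂ (fun x : ℂ => 1 + 1 / x) a := by fun_prop (disch := assumption)
  exact (((d0.mul d1).add (d2.div_const _)).sub ((d4.div_const _).mul (d3.div_const _))).add
    ((differentiableAt_id.mul_const _).mul ((d5.mul d6).div d7 h7))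

lemma J₂_one_two_ne_zero (hq0 : q ≠ 0) (hq : ‖q‖ < 1) : J₂ q 1 2 ≠ 0 := by
  have hq2 := norm_pow_lt_one hq two_ne_zero
  rw [J₂_one_two hq0]
  exact mul_ne_zero (pow_ne_zero _ (qPochInf_ne_zero_of_norm_lt hq2 hq))
    (qPochInf_ne_zero_of_norm_lt hq2 hq2)

/-- Puts the telescoping limit in the form that cancels the inhomogeneous term of m(a²,q²,-1) in
`defect_q_mul`. -/
lemma qPochInf_boundary (hq0 : q ≠ 0) (hq : ‖q‖ < 1) {a : ℂ} (ha : a ≠ 0) :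
    qPochInf (-a * q) q * qPochInf (-1 / a) q / qPochInf q (q ^ 2) =
      jTheta (-a) q / (a * J₂ q 1 2) := by
  have hq2 := norm_pow_lt_one hq two_ne_zero
  have h1 := qPochInf_ne_zero_of_norm_lt hq2 hq
  have h2 := qPochInf_ne_zero_of_norm_lt hq2 hq2
  rw [J₂_one_two hq0, jTheta, qPochInf_q_eq hq, qPochInf_eq_mul hq (-a),
    qPochInf_eq_mul hq (-1 / a), show q * -a = -a * q by ring,
    show q * (-1 / a) = q / -a by field_simp]
  field_simp
  ring

lemma defect_q_mul (hq0 : q ≠ 0) (hq : ‖q‖ < 1) {a : ℂ} (h : Regular q a) :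
    defect q (q * a) = -a * defect q a := by
  have ha := h.1
  have hq2 := norm_pow_lt_one hq two_ne_zero
  have hq4 := norm_pow_lt_one hq four_ne_zero
  have e1 := tsum_mockTerm_q_mul hq0 hq ha
  rw [qPochInf_boundary hq0 hq ha] at e1
  have e2 := lerchSum_q_mul hq0 hq ha h.zpow_add_ne_zero
  have e3 := lerchSum_q_mul (pow_ne_zero 2 hq0) hq2 (pow_ne_zero 2 ha) h.sq_zpow_add_ne_zero
  have e4 := jTheta_q_mul hq hq0 (neg_ne_zero.2 ha)
  have e5 := jTheta_q_mul hq hq0 ha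
  have e6 := jTheta_q_mul hq2 (pow_ne_zero 2 hq0) (mul_ne_zero hq0 (pow_ne_zero 2 ha))
  have e7 := jTheta_q_mul hq4 (pow_ne_zero 4 hq0) (pow_ne_zero 4 ha)
  have h7 := ((regular_iff hq0 hq a).1 h).2
  have hJ := J₂_one_two_ne_zero hq0 hq
  have ht := jTheta_neg_one_ne_zero hq
  have ht2 := jTheta_neg_one_ne_zero hq2
  -- The -1 from the telescoped series cancels j(-1;q)/j(-1;q) from the first Lerch sum; the theta
  -- boundary term cancels against the second. Every remaining term acquires the factor -a.
  unfold defect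
  rw [eq_sub_of_add_eq e1, e2, show (q * a) ^ 2 = q ^ 2 * a ^ 2 by ring, e3,
    show -(q * a) = q * -a by ring, e4, e5,
    show q * (q ^ 2 * a ^ 2) = q ^ 2 * (q * a ^ 2) by ring, e6,
    show (q * a) ^ 4 = q ^ 4 * a ^ 4 by ring, e7]
  generalize J₁ q 4 ^ 3 / J₁ q 2 ^ 3 = c
  generalize lerchSum a q = l1
  generalize lerchSum (a ^ 2) (q ^ 2) = l2
  generalize ∑' n, mockTerm q a n = F
  generalize jTheta (a ^ 4) (q ^ 4) = T at *
  generalize jTheta (-1) (q ^ 2) = t2 at *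
  generalize jTheta (-1) q = t1 at *
  field_simp
  ring

/-! ### Residues at the fourth roots of unity -/

/-- The vanishing factor is 1 - a⁴ = -(a - p)(a + p)(a² + p²). The other factors of the theta
function tend to J₄³, and 1/(4p³) = p/4. -/
lemma tendsto_div_jTheta_pow_four (hq : ‖q‖ < 1) (hq0 : q ≠ 0) {p : ℂ} (hp : p ^ 4 = 1) :
    Tendsto (fun a => (a - p) / jTheta (a ^ 4) (q ^ 4)) (𝓝[≠] p)
      (𝓝 (-p / (4 * J₁ q 4 ^ 3))) := by
  have hq4 := norm_pow_lt_one hq four_ne_zero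
  have hp0 : p ≠ 0 := by rintro rfl; norm_num at hp
  have hE := qPochInf_ne_zero_of_norm_lt hq4 hq4
  let K : ℂ → ℂ := fun a => qPochInf (q ^ 4 * a ^ 4) (q ^ 4) * qPochInf (q ^ 4 / a ^ 4) (q ^ 4) *
    qPochInf (q ^ 4) (q ^ 4)
  have hc := (differentiable_qPochInf hq4).continuous
  have hK : ContinuousAt K p := by
    refine ContinuousAt.mul (ContinuousAt.mul ?_ ?_) continuousAt_const
    · exact hc.continuousAt.comp (f := fun a : ℂ => q ^ 4 * a ^ 4) (by fun_prop)
    · exact hc.continuousAt.comp (f := fun a : ℂ => q ^ 4 / a ^ 4)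
        (continuousAt_const.div (by fun_prop) (pow_ne_zero 4 hp0))
  have hKp : K p = J₁ q 4 ^ 3 := by
    rw [J₁_eq hq hq0 four_ne_zero]
    simp only [K, hp, mul_one, div_one]
    ring
  have hden : ContinuousAt (fun a => -1 / ((a + p) * (a ^ 2 + p ^ 2) * K a)) p := by
    refine continuousAt_const.div (ContinuousAt.mul (by fun_prop) hK) ?_
    rw [hKp, J₁_eq hq hq0 four_ne_zero]
    refine mul_ne_zero (mul_ne_zero ?_ ?_) (pow_ne_zero _ hE)
    · rw [← two_mul]; simpa using hp0
    · rw [← two_mul]; simpa using hp0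
  have h1 := hden.tendsto.mono_left (nhdsWithin_le_nhds (s := {p}ᶜ))
  have hJ : J₁ q 4 ≠ 0 := by rw [J₁_eq hq hq0 four_ne_zero]; exact hE
  have e : -1 / ((p + p) * (p ^ 2 + p ^ 2) * K p) = -p / (4 * J₁ q 4 ^ 3) := by
    rw [hKp]
    field_simp
    linear_combination 4 * hp
  rw [e] at h1
  refine h1.congr' ?_
  filter_upwards [self_mem_nhdsWithin] with a ha
  have ha' : a - p ≠ 0 := sub_ne_zero.2 ha
  have e2 : jTheta (a ^ 4) (q ^ 4) = (a - p) * (-((a + p) * (a ^ 2 + p ^ 2) * K a)) := by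
    rw [jTheta, qPochInf_eq_mul hq4 (a ^ 4)]
    simp only [K]
    linear_combination (-1) * (qPochInf (q ^ 4 * a ^ 4) (q ^ 4) *
      qPochInf (q ^ 4 / a ^ 4) (q ^ 4) * qPochInf (q ^ 4) (q ^ 4)) * hp
  rw [e2, ← div_div (a - p), div_self ha', neg_div, one_div, one_div, inv_neg]

/-- Exceptional points are zeros of j(a⁴;q⁴), analytic on the connected set ℂ \ {0}. It is not
identically zero, because its zero at 1 is simple, so its zeros are isolated. -/
lemma eventually_regular (hq0 : q ≠ 0) (hq : ‖q‖ < 1) {a : ℂ} (ha : a ≠ 0) :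
    ∀ᶠ x in 𝓝[≠] a, Regular q x := by
  have hq4 := norm_pow_lt_one hq four_ne_zero
  have hE := qPochInf_ne_zero_of_norm_lt hq4 hq4
  have hA : AnalyticOnNhd ℂ (fun x => jTheta (x ^ 4) (q ^ 4)) {0}ᶜ := by
    refine DifferentiableOn.analyticOnNhd (fun x hx => ?_) isOpen_compl_singleton
    exact ((differentiableAt_jTheta hq4 (pow_ne_zero 4 hx)).comp x
      (f := fun x => x ^ 4) (by fun_prop)).differentiableWithinAt
  have hconn : IsPreconnected ({0}ᶜ : Set ℂ) :=
    (isConnected_compl_singleton_of_one_lt_rank (by simp) 0).isPreconnected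
  have h1 : ∀ᶠ x in 𝓝[≠] (1 : ℂ), jTheta (x ^ 4) (q ^ 4) ≠ 0 := by
    have h := tendsto_div_jTheta_pow_four hq hq0 (one_pow 4)
    have hne : (-1 : ℂ) / (4 * J₁ q 4 ^ 3) ≠ 0 := by simp [J₁_eq hq hq0 four_ne_zero, hE]
    filter_upwards [h.eventually (isOpen_ne.mem_nhds hne)] with x hx h0
    exact hx (by rw [h0, div_zero])
  have h0 : ∀ᶠ x in 𝓝[≠] (1 : ℂ), x ≠ 0 :=
    mem_nhdsWithin_of_mem_nhds (isOpen_ne.mem_nhds one_ne_zero)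
  obtain ⟨b, hb, hb0⟩ := (h1.and h0).exists
  have h2 : ∀ᶠ x in 𝓝[≠] a, jTheta (x ^ 4) (q ^ 4) ≠ 0 := by
    rcases (hA a ha).eventually_eq_zero_or_eventually_ne_zero with h | h
    · exact absurd (hA.eqOn_zero_of_preconnected_of_eventuallyEq_zero hconn ha h hb0) hb
    · exact h
  filter_upwards [h2, mem_nhdsWithin_of_mem_nhds (isOpen_ne.mem_nhds ha)] with x hx hx0
  exact (regular_iff hq0 hq x).2 ⟨hx0, hx⟩

/-- The residue cancellation at a = -1; it reduces to the fourth power of Euler's identity. -/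
lemma theta_product_neg_one (hq0 : q ≠ 0) (hq : ‖q‖ < 1) :
    jTheta (-1) q ^ 2 * jTheta q (q ^ 2) = 4 * J₁ q 2 ^ 3 := by
  have h := qPochInf_neg_mul_odd hq
  rw [jTheta_neg_one hq, J₁_eq hq hq0 two_ne_zero, jTheta, show q ^ 2 / q = q by field_simp,
    qPochInf_q_eq hq]
  have h2 := qPochInf_mul_neg hq q
  rw [qPochInf_q_eq hq] at h2
  generalize qPochInf (-q) q = u at *
  generalize qPochInf q (q ^ 2) = o at *
  generalize qPochInf (q ^ 2) (q ^ 2) = e at *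
  linear_combination 4 * e ^ 3 * (u ^ 3 * o ^ 3 + u ^ 2 * o ^ 2 + u * o + 1) * h

/-- The residue cancellation at a = ±i; it reduces to the square of Euler's identity. -/
lemma theta_product_even (hq0 : q ≠ 0) (hq : ‖q‖ < 1) :
    J₂ q 1 2 * jTheta (-1) (q ^ 2) * jTheta (-q) (q ^ 2) = 2 * J₁ q 2 ^ 3 := by
  have hq2 := norm_pow_lt_one hq two_ne_zero
  have h := qPochInf_neg_mul_odd hq
  have h2 : qPochInf (-q) q = qPochInf (-q) (q ^ 2) * qPochInf (-q ^ 2) (q ^ 2) := by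
    rw [qPochInf_eq_prod hq (-q) two_ne_zero]
    simp [Finset.prod_range_succ, pow_two]
  rw [h2] at h
  rw [jTheta_neg_one hq2, J₁_eq hq hq0 two_ne_zero, jTheta,
    show q ^ 2 / -q = -q by field_simp, J₂_one_two hq0]
  generalize qPochInf (-q) (q ^ 2) = u at *
  generalize qPochInf (-q ^ 2) (q ^ 2) = v at *
  generalize qPochInf q (q ^ 2) = o at *
  generalize qPochInf (q ^ 2) (q ^ 2) = e at *
  linear_combination 2 * e ^ 3 * (u * v * o + 1) * h

/-- Here q/p = -qp, so p ↦ -p permutes the factors, except that 1 - p becomes 1 + p = p(1 - p). -/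
lemma jTheta_neg_of_sq_eq_neg_one (hq : ‖q‖ < 1) {p : ℂ} (hp : p ^ 2 = -1) :
    jTheta (-p) q = p * jTheta p q := by
  have hp0 : p ≠ 0 := by rintro rfl; norm_num at hp
  have e1 : q / p = q * -p := by
    rw [div_eq_iff hp0]; linear_combination q * hp
  have e2 : q / -p = q * p := by
    rw [div_eq_iff (neg_ne_zero.2 hp0)]; linear_combination q * hp
  rw [jTheta, jTheta, e1, e2, qPochInf_eq_mul hq p, qPochInf_eq_mul hq (-p)]
  linear_combination (qPochInf (q * -p) q * qPochInf (q * p) q * qPochInf q q) * hp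

lemma tendsto_sub_mul_of_continuousAt {f : ℂ → ℂ} {p : ℂ} (hf : ContinuousAt f p) :
    Tendsto (fun a => (a - p) * f a) (𝓝[≠] p) (𝓝 0) := by
  have h : ContinuousAt (fun a => (a - p) * f a) p := by fun_prop
  simpa using h.tendsto.mono_left (nhdsWithin_le_nhds (s := {p}ᶜ))

lemma norm_eq_one_of_pow {x : ℂ} {n : ℕ} (h : x ^ n = 1) (hn : n ≠ 0) : ‖x‖ = 1 := by
  rw [← pow_eq_one_iff_of_nonneg (norm_nonneg x) hn, ← norm_pow, h, norm_one]

lemma tendsto_sub_mul_lerchSum (hq0 : q ≠ 0) (hq : ‖q‖ < 1) {p : ℂ} (hp : p ^ 4 = 1) :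
    Tendsto (fun a => (a - p) * lerchSum a q) (𝓝[≠] p) (𝓝 (if p = -1 then 1 else 0)) := by
  have hp0 : p ≠ 0 := by rintro rfl; norm_num at hp
  have hpn : ‖p‖ = 1 := norm_eq_one_of_pow hp four_ne_zero
  split_ifs with h
  · subst h
    simpa [add_comm] using tendsto_lerchSum_neg_one hq0 hq
  · refine tendsto_sub_mul_of_continuousAt
      (differentiableAt_lerchSum hq0 hq hp0 fun s hs => ?_).continuousAt
    have h1 := eq_neg_of_add_eq_zero_left hs
    by_cases hs0 : s = 0
    · subst hs0; exact h (by rw [zpow_zero] at h1; rw [h1, neg_neg])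
    · exact norm_zpow_ne_one hq hs0 (by rw [h1, norm_neg, hpn])

lemma tendsto_sub_mul_lerchSum_sq (hq0 : q ≠ 0) (hq : ‖q‖ < 1) {p : ℂ} (hp : p ^ 4 = 1) :
    Tendsto (fun a => (a - p) * lerchSum (a ^ 2) (q ^ 2)) (𝓝[≠] p)
      (𝓝 (if p ^ 2 = -1 then 1 / (2 * p) else 0)) := by
  have hp0 : p ≠ 0 := by rintro rfl; norm_num at hp
  have hpn : ‖p ^ 2‖ = 1 := norm_eq_one_of_pow (n := 2) (by rw [← hp]; ring) two_ne_zero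
  have hq2 := norm_pow_lt_one hq two_ne_zero
  have hq20 := pow_ne_zero 2 hq0
  split_ifs with h
  · have hne : ∀ᶠ a in 𝓝 p, a + p ≠ 0 :=
      (continuous_add_const p).continuousAt.eventually_ne (by rw [← two_mul]; simpa using hp0)
    have hne' : ∀ᶠ a in 𝓝[≠] p, a + p ≠ 0 := hne.filter_mono nhdsWithin_le_nhds
    have ht : Tendsto (fun a : ℂ => a ^ 2) (𝓝[≠] p) (𝓝[≠] (-1)) := by
      refine tendsto_nhdsWithin_iff.2 ⟨?_, ?_⟩
      · rw [← h]; exact ((continuous_pow 2).tendsto p).mono_left nhdsWithin_le_nhds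
      · filter_upwards [self_mem_nhdsWithin, hne'] with a ha hn h0
        rw [Set.mem_singleton_iff, ← h] at h0
        exact mul_ne_zero (sub_ne_zero.2 ha) hn (by linear_combination h0)
    have h1 := (tendsto_lerchSum_neg_one hq20 hq2).comp ht
    have h2 : Tendsto (fun a => (a + p)⁻¹) (𝓝[≠] p) (𝓝 (p + p)⁻¹) :=
      (((continuous_add_const p).tendsto p).inv₀ (by rw [← two_mul]; simpa using hp0)).mono_left
        nhdsWithin_le_nhds
    have h3 := h2.mul h1
    rw [mul_one, ← two_mul, inv_eq_one_div] at h3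
    refine h3.congr' ?_
    filter_upwards [hne'] with a ha
    have e : 1 + a ^ 2 = (a + p) * (a - p) := by linear_combination h
    simp only [Function.comp]
    rw [e]
    field_simp
  · refine tendsto_sub_mul_of_continuousAt (f := fun a => lerchSum (a ^ 2) (q ^ 2)) ?_
    refine ContinuousAt.comp (f := fun a : ℂ => a ^ 2) (g := fun x => lerchSum x (q ^ 2))
      (differentiableAt_lerchSum hq20 hq2 (pow_ne_zero 2 hp0) fun s hs => ?_).continuousAt
      (by fun_prop)
    have h1 := eq_neg_of_add_eq_zero_left hs
    by_cases hs0 : s = 0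
    · subst hs0; exact h (by rw [zpow_zero] at h1; rw [h1, neg_neg])
    · exact norm_zpow_ne_one hq2 hs0 (by rw [h1, norm_neg, hpn])

/-- The residues of the defect at the fourth roots of unity cancel. -/
lemma residue_sum_eq_zero (hq0 : q ≠ 0) (hq : ‖q‖ < 1) {p : ℂ} (hp : p ^ 4 = 1) :
    0 + (if p = -1 then 1 else 0) / jTheta (-1) q
      - jTheta (-p) q / J₂ q 1 2 *
        ((if p ^ 2 = -1 then 1 / (2 * p) else 0) / jTheta (-1) (q ^ 2))
      + p * (J₁ q 4 ^ 3 / J₁ q 2 ^ 3)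
        * (jTheta p q * jTheta (q * p ^ 2) (q ^ 2) * (-p / (4 * J₁ q 4 ^ 3))) = 0 := by
  have hp0 : p ≠ 0 := by rintro rfl; norm_num at hp
  have hq2 := norm_pow_lt_one hq two_ne_zero
  have hq4 := norm_pow_lt_one hq four_ne_zero
  have hE2 : J₁ q 2 ≠ 0 := by
    rw [J₁_eq hq hq0 two_ne_zero]; exact qPochInf_ne_zero_of_norm_lt hq2 hq2
  have hE4 : J₁ q 4 ≠ 0 := by
    rw [J₁_eq hq hq0 four_ne_zero]; exact qPochInf_ne_zero_of_norm_lt hq4 hq4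
  have hJ := J₂_one_two_ne_zero hq0 hq
  have ht := jTheta_neg_one_ne_zero hq
  have ht2 := jTheta_neg_one_ne_zero hq2
  -- At 1 the theta quotient has no pole since j(1;q) = 0. At -1 its residue meets that of
  -- m(a,q,-1), and at ±i that of m(a²,q²,-1).
  have hcases : (p - 1) * ((p + 1) * (p ^ 2 + 1)) = 0 := by linear_combination hp
  rcases mul_eq_zero.1 hcases with h | h
  · obtain rfl : p = 1 := by linear_combination h
    rw [jTheta_one q hq]
    norm_num
  rcases mul_eq_zero.1 h with h | h
  · obtain rfl : p = -1 := by linear_combination h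
    have h1 := theta_product_neg_one hq0 hq
    rw [neg_neg, jTheta_one q hq]
    norm_num
    field_simp
    linear_combination -h1
  · have h : p ^ 2 = -1 := by linear_combination h
    have hne : p ≠ -1 := by rintro rfl; norm_num at h
    have h1 := theta_product_even hq0 hq
    rw [if_neg hne, if_pos h, zero_div, jTheta_neg_of_sq_eq_neg_one hq h, h, mul_neg_one]
    generalize jTheta (-1) (q ^ 2) = t2 at *
    generalize jTheta (-q) (q ^ 2) = t3 at *
    field_simp
    rw [h]
    linear_combination 2 * jTheta p q * h1

lemma tendsto_sub_mul_defect (hq0 : q ≠ 0) (hq : ‖q‖ < 1) {p : ℂ} (hp : p ^ 4 = 1) :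
    Tendsto (fun a => (a - p) * defect q a) (𝓝[≠] p) (𝓝 0) := by
  have hp0 : p ≠ 0 := by rintro rfl; norm_num at hp
  have hq2 := norm_pow_lt_one hq two_ne_zero
  have hw : 𝓝[≠] p ≤ 𝓝 p := nhdsWithin_le_nhds
  have l1 : Tendsto (fun a => (a - p) * ((1 + 1 / a) * ∑' n, mockTerm q a n)) (𝓝[≠] p) (𝓝 0) :=
    tendsto_sub_mul_of_continuousAt (ContinuousAt.mul (by fun_prop (disch := assumption))
      (differentiableAt_tsum_mockTerm hq hp0).continuousAt)
  have l2 := (tendsto_sub_mul_lerchSum hq0 hq hp).div_const (jTheta (-1) q)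
  have l3 := (tendsto_sub_mul_lerchSum_sq hq0 hq hp).div_const (jTheta (-1) (q ^ 2))
  have c4 : ContinuousAt (fun a => jTheta (-a) q) p :=
    (differentiableAt_jTheta hq (neg_ne_zero.2 hp0)).continuousAt.comp
      (f := fun a : ℂ => -a) (by fun_prop)
  have l4 := (c4.tendsto.mono_left hw).div_const (J₂ q 1 2)
  have l5 := (differentiableAt_jTheta hq hp0).continuousAt.tendsto.mono_left hw
  have c6 : ContinuousAt (fun a => jTheta (q * a ^ 2) (q ^ 2)) p :=
    (differentiableAt_jTheta hq2 (mul_ne_zero hq0 (pow_ne_zero 2 hp0))).continuousAt.comp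
      (f := fun a : ℂ => q * a ^ 2) (by fun_prop)
  have l6 := c6.tendsto.mono_left hw
  have l7 := tendsto_div_jTheta_pow_four hq hq0 hp
  have l8 : Tendsto (fun a : ℂ => a * (J₁ q 4 ^ 3 / J₁ q 2 ^ 3)) (𝓝[≠] p)
      (𝓝 (p * (J₁ q 4 ^ 3 / J₁ q 2 ^ 3))) := ((tendsto_id.mul_const _).mono_left hw)
  have l := ((l1.add l2).sub (l4.mul l3)).add (l8.mul ((l5.mul l6).mul l7))
  rw [residue_sum_eq_zero hq0 hq hp] at l
  refine l.congr fun a => ?_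
  rw [defect]
  ring

/-- Comparing absolute values in a⁴ = q^{4k} over the annulus forces k = 0. -/
lemma pow_four_eq_one_of_not_regular (hq0 : q ≠ 0) (hq : ‖q‖ < 1) {a : ℂ} (h1 : ‖q‖ < ‖a‖)
    (h2 : ‖a‖ ≤ 1) (h : ¬ Regular q a) : a ^ 4 = 1 := by
  have hp : 0 < ‖q‖ := norm_pos_iff.2 hq0
  have ha0 : a ≠ 0 := norm_pos_iff.1 (hp.trans h1)
  obtain ⟨k, hk⟩ : ∃ k : ℤ, a ^ 4 = q ^ (4 * k) := by
    by_contra! hc; exact h ⟨ha0, hc⟩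
  have hn := congrArg norm hk
  rw [norm_pow, norm_zpow] at hn
  have h3 : ‖q‖ ^ (4 : ℤ) < ‖q‖ ^ (4 * k) := by
    rw [← hn]; exact pow_lt_pow_left₀ h1 hp.le four_ne_zero
  have h4 : ‖q‖ ^ (4 * k) ≤ ‖q‖ ^ (0 : ℤ) := by
    rw [← hn, zpow_zero]; exact pow_le_one₀ (norm_nonneg a) h2
  rw [zpow_lt_zpow_iff_right_of_lt_one₀ hp hq] at h3
  rw [zpow_le_zpow_iff_right_of_lt_one₀ hp hq] at h4
  obtain rfl : k = 0 := by lia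
  simpa using hk

/-! ### Vanishing of the defect -/

lemma defect_eq_zero (hq0 : q ≠ 0) (hq : ‖q‖ < 1) {a : ℂ} (h : Regular q a) :
    defect q a = 0 := by
  -- The theta factor has multiplier -a⁻¹, cancelling the multiplier -a of the defect.
  let f : ℂ → ℂ := fun x => defect q x * jTheta x q
  have hfd : ∀ x, Regular q x → DifferentiableAt ℂ f x := fun x hx =>
    (differentiableAt_defect hq0 hq hx).mul (differentiableAt_jTheta hq hx.1)
  have hp : 0 < ‖q‖ := norm_pos_iff.2 hq0
  obtain ⟨c, hc⟩ := exists_eventuallyEq_const hq0 hq (h := f) (fun x h1 h2 => by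
      have hx0 : x ≠ 0 := norm_pos_iff.1 (hp.trans h1)
      refine removableAt_of_tendsto ((eventually_regular hq0 hq hx0).mono hfd) ?_
      by_cases hx : Regular q x
      · exact tendsto_sub_mul_of_continuousAt (hfd x hx).continuousAt
      · have l := (tendsto_sub_mul_defect hq0 hq
          (pow_four_eq_one_of_not_regular hq0 hq h1 h2 hx)).mul
            ((differentiableAt_jTheta hq hx0).continuousAt.tendsto.mono_left
              (nhdsWithin_le_nhds (s := {x}ᶜ)))
        rw [zero_mul] at l
        exact l.congr fun y => mul_assoc _ _ _)
    (fun x hx => (eventually_regular hq0 hq hx).mono fun y hy => by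
      have := hy.1
      simp only [f]
      rw [defect_q_mul hq0 hq hy, jTheta_q_mul hq hq0 hy.1]
      field_simp)
  -- Near 1, f is (x - 1) times the defect, which tends to 0, times the difference quotient of
  -- j(x;q) at its zero 1, which stays bounded.
  have hc0 : c = 0 := by
    have l1 := tendsto_sub_mul_defect hq0 hq (one_pow 4)
    have l2 := (differentiableAt_jTheta hq (one_ne_zero)).hasDerivAt.tendsto_slope
    have l := l1.mul l2
    rw [zero_mul] at l
    refine tendsto_nhds_unique (tendsto_const_nhds.congr' ?_) l
    filter_upwards [hc 1 one_ne_zero, self_mem_nhdsWithin] with x hx hx1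
    have hx1 : x - 1 ≠ 0 := sub_ne_zero.2 hx1
    rw [← hx, slope_def_field, jTheta_one q hq]
    simp only [f]
    field_simp
    ring
  have l := (hfd a h).continuousAt.tendsto.mono_left (nhdsWithin_le_nhds (s := {a}ᶜ))
  have l' := tendsto_nhds_unique l ((tendsto_congr' (hc a h.1)).2 tendsto_const_nhds)
  rw [hc0] at l'
  exact (mul_eq_zero.1 l').resolve_right (h.jTheta_ne_zero hq0 hq)

end

end AppellLerch

theorem mainTheorem7 (q a : ℂ) (hq0 : q ≠ 0) (hq1 : ‖q‖ < 1) (ha0 : a ≠ 0)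
    (ha : ∀ k : ℤ, a ^ 4 ≠ q ^ (4 * k)) :
    Summable (fun n : ℕ =>
      AppellLerch.qPoch (-a * q) q n * AppellLerch.qPoch (-q / a) q n * q ^ (n + 1) /
        AppellLerch.qPoch q (q ^ 2) (n + 1)) ∧
    (1 + 1 / a) * ∑' n : ℕ,
      AppellLerch.qPoch (-a * q) q n * AppellLerch.qPoch (-q / a) q n * q ^ (n + 1) /
        AppellLerch.qPoch q (q ^ 2) (n + 1)
      = -AppellLerch.appellM a q (-1)
        + AppellLerch.jTheta (-a) q / AppellLerch.J₂ q 1 2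
            * AppellLerch.appellM (a ^ 2) (q ^ 2) (-1)
        - a * (AppellLerch.J₁ q 4 ^ 3 / AppellLerch.J₁ q 2 ^ 3)
            * (AppellLerch.jTheta a q * AppellLerch.jTheta (q * a ^ 2) (q ^ 2)
                / AppellLerch.jTheta (a ^ 4) (q ^ 4)) := by
  have h : AppellLerch.Regular q a := ⟨ha0, ha⟩
  refine ⟨AppellLerch.summable_mockTerm hq1 ha0, ?_⟩
  have hd := AppellLerch.defect_eq_zero hq0 hq1 h
  rw [AppellLerch.defect] at hd
  rw [AppellLerch.appellM_neg_one hq0, AppellLerch.appellM_neg_one (pow_ne_zero 2 hq0)]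
  change (1 + 1 / a) * ∑' n, AppellLerch.mockTerm q a n = _
  linear_combination hd
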